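/- Let $k\ge 2$ be an integer. For $i\ge 0$ put $A_i=\begin{pmatrix} i+1 & 1\\ 1 & 0\end{pmatrix}$, and for an integer $n\ge 0$ with base-$k$ expansion $n=i_0+i_1k+\cdots+i_sk^s$ (digits $0\le i_j\le k-1$) let $$\kappa(n)=\begin{pmatrix}1&0\end{pmatrix}A_{i_0}A_{i_1}\cdots A_{i_s}\begin{pmatrix}1\\0\end{pmatrix},\qquad \kappa(0)=1.$$ Let $K(z)=\sum_{n\ge 0}\kappa(n)z^n$ and $$\alpha_k=\frac{k(k+1)+k\sqrt{(k+1)^2+16}}{4}.$$ Then the series $K(z)$ converges for all real $z$ with $|z|<1$, and there is a function $C$, depending only on $k$, such that: 1. $C$ is real-valued and real-analytic on $(0,1)$; 2. $C$ is bounded away from $0$ and $\infty$ on $(0,1)$, and positive: there are constants $c_1,c_2>0$ with $c_1\le C(z)\le c_2$ for all $z\in(0,1)$; 3. $C(z)=C(z^k)$ for all $z\in(0,1)$; 4. $C$ is oscillatory: $C(z)$ does not tend to a limit as $z\to 1^-$; 5. for every integer $m\ge 0$, as $z\to 1^-$ through real values, $$K(z^{k^m})=\frac{1}{\alpha_k^{m}}\cdot\frac{C(z)}{(1-z)^{\log_k\alpha_k}}\cdot(1+o(1)).$$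 -/

import Mathlib

open Set Filter Topology Asymptotics

noncomputable section

namespace Zaremba

/-- The matrix `A_i` with rows `(i + 1, 1)` and `(1, 0)`. -/
def digitMatrix (i : ℕ) : Matrix (Fin 2) (Fin 2) ℤ :=
  !![(i : ℤ) + 1, 1; 1, 0]

/-- `κ(n) = [1 0] A_{i₀} A_{i₁} ⋯ A_{i_s} [1 0]ᵀ`, where `n = i₀ + i₁ k + ⋯ + i_s k ^ s` in base
`k`. The list `Nat.digits k n` is `[i₀, i₁, …, i_s]`, least significant digit first;
it is empty for `n = 0`, so that `κ(0) = 1` (the digit string `0` would give the same value). -/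
def kappa (k n : ℕ) : ℤ :=
  ![1, 0] ⬝ᵥ (((Nat.digits k n).map digitMatrix).prod.mulVec ![1, 0])

/-- The generating function `K(z) = ∑_{n ≥ 0} κ(n) zⁿ` at a real point. -/
def K (k : ℕ) (z : ℝ) : ℝ :=
  ∑' n : ℕ, (kappa k n : ℝ) * z ^ n

/-- `α_k = (k(k+1) + k √((k+1)² + 16)) / 4`. -/
def alpha (k : ℕ) : ℝ :=
  ((k : ℝ) * (k + 1) + k * Real.sqrt (((k : ℝ) + 1) ^ 2 + 16)) / 4

end Zaremba

end

/-!
Write `z = e^{-t}`. Summation by parts gives `K(e^{-t}) = t ∫₀^∞ e^{-tx} S(x) dx`, where `S(x)` is the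
sum of `κ(n)` over `0 ≤ n ≤ x` (`K_exp_neg`), so that the behaviour of `K` at `1` is governed by the
growth of `S`.

Prepending a digit to `n` multiplies the vector `(κ(n), λ(n))` by some `A_i`, where `λ(n)` is `κ` of
`n` with its lowest digit removed. Hence the summatory function of `x κ + k λ` is multiplied by `x`,
up to a constant, when its argument is multiplied by `k`, for each of the two roots `x = α_k, β_k` of
`x² = (k (k + 1) / 2) x + k²` (`eigenSum_mul`). The `α_k`-component, shifted by a constant, satisfies
`f (k N) = α_k f N` exactly, and as a monotone function it extends to a monotone `g` on `(0, ∞)` with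
`g (k x) = α_k g x` (`homogExt`). The `β_k`-component and the jumps of `f` are of order at most
`(k + 1) ^ (log_k N)`, and `k + 1 < α_k`; therefore `S` is asymptotic to a multiple of `g`
(`tendsto_sumKappa_div`). The homogeneity also puts `g` between two multiples of `x ^ s`, where
`s = log_k α_k`.

Let `g` now denote the normalized function `sumModel`, to which `S` is asymptotic, and put
`C(e^{-t}) = t ^ (s + 1) ∫₀^∞ e^{-tx} g(x) dx`. Bounds and invariance under `t ↦ k t` are inherited
from `g`, analyticity is that of moment generating functions, and the asymptotics of `K` follow from
an Abelian theorem (`tendsto_laplace_div`). If `C` had a limit at `1`, invariance would make it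
constant, and uniqueness of Laplace transforms (`ae_eq_of_laplace_eq`) would give `g(x) = c x ^ s`.
Then `g (k ^ n + 1) - g (k ^ n)` would be at least `c (α_k / k) ^ n ≥ c 2 ^ n`; but this increment is
a fixed combination of `κ(k ^ n)` and `λ(k ^ n)`, which grow like Fibonacci numbers
(`not_sumModel_eq_rpow`).
-/

namespace Zaremba

/-! ### Recursions for `κ` -/

/-- The second entry of the vector `A_{i₀} ⋯ A_{i_s} (1, 0)ᵀ` whose first entry is `κ(n)`.
Deleting the lowest digit of `n ≥ 1` leaves the digits of `n / k`, so the entry is `κ(n / k)`;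
the empty digit string of `n = 0` gives `0`. -/
noncomputable def lam (k n : ℕ) : ℝ := if n = 0 then 0 else (kappa k (n / k) : ℝ)

/-- The product `A_{i₀} ⋯ A_{i_s} (1, 0)ᵀ` over the base-`k` digits of `n`. -/
def digitVec (k n : ℕ) : Fin 2 → ℤ := ((Nat.digits k n).map digitMatrix).prod.mulVec ![1, 0]

lemma kappa_eq_digitVec (k n : ℕ) : kappa k n = digitVec k n 0 := by
  simp [kappa, digitVec, dotProduct, Fin.sum_univ_two]

lemma digitVec_zero (k : ℕ) : digitVec k 0 = ![1, 0] := by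
  simp [digitVec]

lemma digitVec_of_pos {k n : ℕ} (hk : 2 ≤ k) (hn : 0 < n) :
    digitVec k n = (digitMatrix (n % k)).mulVec (digitVec k (n / k)) := by
  rw [digitVec, Nat.digits_def' (by omega) hn, List.map_cons, List.prod_cons,
    ← Matrix.mulVec_mulVec]
  rfl

lemma kappa_zero (k : ℕ) : kappa k 0 = 1 := by
  rw [kappa_eq_digitVec, digitVec_zero]; rfl

lemma lam_eq_digitVec {k : ℕ} (hk : 2 ≤ k) (n : ℕ) : lam k n = (digitVec k n 1 : ℝ) := by
  rcases Nat.eq_zero_or_pos n with rfl | hn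
  · simp [lam, digitVec_zero]
  · rw [lam, if_neg hn.ne', digitVec_of_pos hk hn, kappa_eq_digitVec]
    simp [digitMatrix, Matrix.mulVec, dotProduct, Fin.sum_univ_two]

lemma kappa_rec {k : ℕ} (hk : 2 ≤ k) (n : ℕ) :
    (kappa k n : ℝ) = ((n % k : ℕ) + 1) * kappa k (n / k) + lam k (n / k) := by
  rcases Nat.eq_zero_or_pos n with rfl | hn
  · simp [lam, kappa_zero]
  · rw [lam_eq_digitVec hk, kappa_eq_digitVec, kappa_eq_digitVec, digitVec_of_pos hk hn]
    simp [digitMatrix, Matrix.mulVec, dotProduct, Fin.sum_univ_two]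
    exact Or.inl (by norm_cast)

lemma kappa_mul_add {k : ℕ} (hk : 2 ≤ k) (n : ℕ) {i : ℕ} (hi : i < k) :
    (kappa k (k * n + i) : ℝ) = (i + 1) * kappa k n + lam k n := by
  rw [kappa_rec hk, Nat.mul_add_mod, Nat.mod_eq_of_lt hi, Nat.mul_add_div (by omega),
    Nat.div_eq_of_lt hi, add_zero]

lemma lam_mul_add {k : ℕ} (n : ℕ) {i : ℕ} (hi : i < k) (h : k * n + i ≠ 0) :
    lam k (k * n + i) = kappa k n := by
  rw [lam, if_neg h, Nat.mul_add_div (by omega), Nat.div_eq_of_lt hi, add_zero]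

lemma one_le_kappa {k : ℕ} (hk : 2 ≤ k) (n : ℕ) : (1 : ℝ) ≤ kappa k n := by
  induction n using Nat.strong_induction_on with
  | _ n ih =>
    rcases Nat.eq_zero_or_pos n with rfl | hn
    · simp [kappa_zero]
    have h1 := ih (n / k) (Nat.div_lt_self hn (by omega))
    have h2 : 0 ≤ lam k (n / k) := by
      unfold lam
      split_ifs with h
      · exact le_rfl
      · have := ih (n / k / k) ((Nat.div_le_self _ _).trans_lt (Nat.div_lt_self hn (by omega)))
        linarith
    rw [kappa_rec hk]
    have h3 : (0 : ℝ) ≤ ((n % k : ℕ) : ℝ) := Nat.cast_nonneg _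
    nlinarith

lemma lam_nonneg {k : ℕ} (hk : 2 ≤ k) (n : ℕ) : 0 ≤ lam k n := by
  unfold lam
  split_ifs
  · exact le_rfl
  · linarith [one_le_kappa hk (n / k)]

lemma lam_le_kappa {k : ℕ} (hk : 2 ≤ k) (n : ℕ) : lam k n ≤ kappa k n := by
  by_cases h : n = 0
  · subst h; simp [lam, kappa_zero]
  · rw [lam, if_neg h, kappa_rec hk n]
    have h1 := one_le_kappa hk (n / k)
    have h2 := lam_nonneg hk (n / k)
    have h3 : (0 : ℝ) ≤ ((n % k : ℕ) : ℝ) := Nat.cast_nonneg _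
    nlinarith

lemma kappa_mul_add_le {k : ℕ} (hk : 2 ≤ k) (n : ℕ) {i : ℕ} (hi : i < k) :
    (kappa k (k * n + i) : ℝ) ≤ (k + 1) * kappa k n := by
  rw [kappa_mul_add hk n hi]
  have h1 := lam_le_kappa hk n
  have h2 := one_le_kappa hk n
  have h3 : (i : ℝ) + 1 ≤ k := by exact_mod_cast hi
  nlinarith

/-- Induction along base-`k` digits: every `n ≥ 1` arises from a nonzero leading digit by
appending digits. -/
lemma digits_induction {k : ℕ} (hk : 2 ≤ k) {P : ℕ → Prop} (base : ∀ d, 0 < d → d < k → P d)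
    (step : ∀ n d, 0 < n → d < k → P n → P (k * n + d)) {n : ℕ} (hn : 0 < n) : P n := by
  induction n using Nat.strong_induction_on with
  | _ n ih =>
    by_cases h : n < k
    · exact base n hn h
    · have := step (n / k) (n % k) (Nat.div_pos (by omega) (by omega)) (Nat.mod_lt _ (by omega))
        (ih _ (Nat.div_lt_self hn (by omega)) (Nat.div_pos (by omega) (by omega)))
      rwa [Nat.div_add_mod] at this

lemma log_mul_add {k n d : ℕ} (hk : 2 ≤ k) (hn : 0 < n) (hd : d < k) :
    Nat.log k (k * n + d) = Nat.log k n + 1 := by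
  rw [Nat.log_of_one_lt_of_le (by omega) (by nlinarith), Nat.mul_add_div (by omega),
    Nat.div_eq_of_lt hd, add_zero]

lemma kappa_le_of_lt {k n : ℕ} (hk : 2 ≤ k) (hn : n < k) : (kappa k n : ℝ) ≤ k + 1 := by
  simpa [kappa_zero] using kappa_mul_add_le hk 0 hn

lemma kappa_le_pow {k n : ℕ} (hk : 2 ≤ k) (hn : 0 < n) :
    (kappa k n : ℝ) ≤ (k + 1) ^ (Nat.log k n + 1) := by
  refine digits_induction (P := fun n ↦ (kappa k n : ℝ) ≤ (k + 1) ^ (Nat.log k n + 1)) hk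
    (fun d _ hd ↦ ?_) (fun n d hn hd ih ↦ ?_) hn
  · simpa [Nat.log_of_lt hd] using kappa_le_of_lt hk hd
  · rw [log_mul_add hk hn hd, pow_succ' _ (_ + 1)]
    exact (kappa_mul_add_le hk n hd).trans (by gcongr)

lemma kappa_le_sq {k : ℕ} (hk : 2 ≤ k) (n : ℕ) :
    (kappa k n : ℝ) ≤ (k + 1) * ((n : ℝ) ^ 2 + 1) := by
  rcases Nat.eq_zero_or_pos n with rfl | hn
  · simp [kappa_zero]
  have hk' : (2 : ℝ) ≤ k := by exact_mod_cast hk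
  have h1 : ((k : ℝ) + 1) ^ Nat.log k n ≤ (n : ℝ) ^ 2 := calc
    ((k : ℝ) + 1) ^ Nat.log k n ≤ ((k : ℝ) ^ 2) ^ Nat.log k n := by
      gcongr; nlinarith
    _ = ((k ^ Nat.log k n : ℕ) : ℝ) ^ 2 := by push_cast; rw [← pow_mul, ← pow_mul, mul_comm]
    _ ≤ (n : ℝ) ^ 2 := by gcongr; exact Nat.pow_log_le_self k hn.ne'
  calc (kappa k n : ℝ) ≤ (k + 1) ^ (Nat.log k n + 1) := kappa_le_pow hk hn
    _ = (k + 1) * ((k : ℝ) + 1) ^ Nat.log k n := by rw [pow_succ']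
    _ ≤ _ := by gcongr; linarith

lemma summable_kappa {k : ℕ} (hk : 2 ≤ k) {z : ℝ} (hz : |z| < 1) :
    Summable fun n : ℕ ↦ (kappa k n : ℝ) * z ^ n := by
  have hz' : ‖|z|‖ < 1 := by simpa using hz
  have h2 := summable_pow_mul_geometric_of_norm_lt_one 2 hz'
  have h0 := summable_geometric_of_norm_lt_one hz'
  refine Summable.of_norm_bounded ((h2.add h0).mul_left ((k : ℝ) + 1)) fun n ↦ ?_
  rw [norm_mul, norm_pow, Real.norm_eq_abs, Real.norm_eq_abs,
    abs_of_nonneg (zero_le_one.trans (one_le_kappa hk n))]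
  calc _ ≤ (k + 1) * ((n : ℝ) ^ 2 + 1) * |z| ^ n := by gcongr; exact kappa_le_sq hk n
    _ = _ := by ring

/-! ### The two eigenvalues of `A_0 + ⋯ + A_{k-1}` -/

/-- The second root `-k² / α_k` of `x² = (k (k + 1) / 2) x + k²`. -/
noncomputable def beta (k : ℕ) : ℝ := (k : ℝ) * (k + 1) / 2 - alpha k

lemma alpha_sq (k : ℕ) : alpha k ^ 2 = (k : ℝ) * (k + 1) / 2 * alpha k + k ^ 2 := by
  have h : Real.sqrt (((k : ℝ) + 1) ^ 2 + 16) ^ 2 = ((k : ℝ) + 1) ^ 2 + 16 :=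
    Real.sq_sqrt (by positivity)
  unfold alpha
  linear_combination (k : ℝ) ^ 2 / 16 * h

lemma beta_sq (k : ℕ) : beta k ^ 2 = (k : ℝ) * (k + 1) / 2 * beta k + k ^ 2 := by
  unfold beta
  linear_combination alpha_sq k

lemma lt_alpha {k : ℕ} (hk : 2 ≤ k) : (k : ℝ) * (k + 1) / 2 < alpha k := by
  have hk' : (2 : ℝ) ≤ k := by exact_mod_cast hk
  have h : (k : ℝ) + 1 < Real.sqrt (((k : ℝ) + 1) ^ 2 + 16) :=
    Real.lt_sqrt_of_sq_lt (by linarith)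
  unfold alpha
  nlinarith

lemma two_mul_le_alpha {k : ℕ} (hk : 2 ≤ k) : 2 * (k : ℝ) ≤ alpha k := by
  have hk' : (2 : ℝ) ≤ k := by exact_mod_cast hk
  have h : (5 : ℝ) ≤ Real.sqrt (((k : ℝ) + 1) ^ 2 + 16) :=
    Real.le_sqrt_of_sq_le (by nlinarith)
  unfold alpha
  nlinarith

lemma add_one_lt_alpha {k : ℕ} (hk : 2 ≤ k) : (k : ℝ) + 1 < alpha k := by
  have hk' : (2 : ℝ) ≤ k := by exact_mod_cast hk
  nlinarith [lt_alpha hk]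

lemma abs_beta_le {k : ℕ} (hk : 2 ≤ k) : |beta k| ≤ k := by
  have hk' : (2 : ℝ) ≤ k := by exact_mod_cast hk
  have h1 := lt_alpha hk
  have h2 := two_mul_le_alpha hk
  have h3 := alpha_sq k
  rw [abs_le]
  unfold beta
  constructor <;> nlinarith

/-- The eigenfunctional `(x, k)` of `A_0 + ⋯ + A_{k-1}` applied to `(κ(n), λ(n))`. -/
noncomputable def eigenForm (k : ℕ) (x : ℝ) (n : ℕ) : ℝ := x * kappa k n + k * lam k n

/-- The summatory function of `eigenForm`. -/
noncomputable def eigenSum (k : ℕ) (x : ℝ) (N : ℕ) : ℝ := ∑ n ∈ Finset.range N, eigenForm k x n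

lemma sum_digit_add_one (k : ℕ) :
    ∑ i ∈ Finset.range k, ((i : ℝ) + 1) = (k : ℝ) * (k + 1) / 2 := by
  induction k with
  | zero => simp
  | succ n ih => rw [Finset.sum_range_succ, ih]; push_cast; ring

lemma sum_kappa_block {k : ℕ} (hk : 2 ≤ k) (n : ℕ) :
    ∑ i ∈ Finset.range k, (kappa k (k * n + i) : ℝ) =
      (k : ℝ) * (k + 1) / 2 * kappa k n + k * lam k n := by
  rw [Finset.sum_congr rfl fun i hi ↦ kappa_mul_add hk n (Finset.mem_range.1 hi),
    Finset.sum_add_distrib, ← Finset.sum_mul, sum_digit_add_one]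
  simp

lemma sum_lam_block {k n : ℕ} (hn : 0 < n) (hk : 2 ≤ k) :
    ∑ i ∈ Finset.range k, lam k (k * n + i) = k * kappa k n := by
  rw [Finset.sum_congr rfl fun i hi ↦ lam_mul_add n (Finset.mem_range.1 hi) (by positivity)]
  simp

lemma sum_lam_block_zero {k : ℕ} (hk : 2 ≤ k) :
    ∑ i ∈ Finset.range k, lam k i = k - 1 := by
  obtain ⟨j, rfl⟩ : ∃ j, k = j + 1 := ⟨k - 1, by omega⟩
  rw [Finset.sum_range_succ', Finset.sum_congr rfl (g := fun _ ↦ (1 : ℝ))]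
  · simp [lam]
  · intro i hi
    have := lam_mul_add (k := j + 1) 0 (i := i + 1) (by have := Finset.mem_range.1 hi; omega)
      (by omega)
    simpa [kappa_zero] using this

lemma sum_eigenForm_block {k n : ℕ} {x : ℝ} (hk : 2 ≤ k) (hn : 0 < n)
    (hx : x ^ 2 = (k : ℝ) * (k + 1) / 2 * x + k ^ 2) :
    ∑ i ∈ Finset.range k, eigenForm k x (k * n + i) = x * eigenForm k x n := by
  simp only [eigenForm]
  rw [Finset.sum_add_distrib, ← Finset.mul_sum, ← Finset.mul_sum, sum_kappa_block hk,
    sum_lam_block hn hk]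
  linear_combination -(kappa k n : ℝ) * hx

/-- The correction `-k` comes from `n = 0`, whose digit string is empty: prepending the digit `0`
to it does not lengthen it. -/
lemma eigenSum_mul {k N : ℕ} {x : ℝ} (hk : 2 ≤ k) (hN : 0 < N)
    (hx : x ^ 2 = (k : ℝ) * (k + 1) / 2 * x + k ^ 2) :
    eigenSum k x (k * N) = x * eigenSum k x N - k := by
  induction N, hN using Nat.le_induction with
  | base =>
    have h1 := sum_kappa_block hk 0
    simp only [mul_zero, zero_add, kappa_zero] at h1
    rw [Nat.succ_eq_add_one, zero_add, mul_one]
    simp only [eigenSum, eigenForm]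
    rw [Finset.sum_add_distrib, ← Finset.mul_sum, ← Finset.mul_sum, sum_lam_block_zero hk, h1]
    simp [kappa_zero, lam]
    linear_combination -hx
  | succ n hn ih =>
    rw [mul_add, mul_one, eigenSum, Finset.sum_range_add, ← eigenSum, ih,
      sum_eigenForm_block hk hn hx, eigenSum, eigenSum, Finset.sum_range_succ]
    ring

lemma abs_eigenForm_le {k : ℕ} {x : ℝ} (hk : 2 ≤ k) (hx : |x| ≤ k) (n : ℕ) :
    |eigenForm k x n| ≤ 2 * k * kappa k n := by
  have h1 := lam_le_kappa hk n
  have h2 := one_le_kappa hk n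
  have h3 := lam_nonneg hk n
  have hk0 : (0 : ℝ) ≤ k := Nat.cast_nonneg k
  refine (abs_add_le _ _).trans ?_
  rw [abs_mul, abs_mul, abs_of_nonneg h3, abs_of_nonneg hk0,
    abs_of_nonneg (by linarith : (0 : ℝ) ≤ kappa k n)]
  nlinarith

/-- The `β`-component of the summatory vector is of lower order than `α ^ (log_k N)`. -/
lemma abs_eigenSum_beta_le {k N : ℕ} (hk : 2 ≤ k) (hN : 0 < N) :
    |eigenSum k (beta k) N| ≤
      (2 * k ^ 2 * (k + 1) + k) * ((k : ℝ) + 1) ^ (Nat.log k N + 1) := by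
  have hk' : (2 : ℝ) ≤ k := by exact_mod_cast hk
  have hform := abs_eigenForm_le hk (abs_beta_le hk)
  have hblock : ∀ (n d : ℕ), d < k → ∑ i ∈ Finset.range d, |eigenForm k (beta k) (k * n + i)| ≤
      2 * k ^ 2 * (k + 1) * kappa k n := by
    intro n d hd
    have h1 := one_le_kappa hk n
    calc ∑ i ∈ Finset.range d, |eigenForm k (beta k) (k * n + i)|
        ≤ ∑ i ∈ Finset.range d, 2 * (k : ℝ) * ((k + 1) * kappa k n) := by
          refine Finset.sum_le_sum fun i hi ↦ (hform _).trans ?_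
          gcongr
          exact kappa_mul_add_le hk n ((Finset.mem_range.1 hi).trans hd)
      _ = d * (2 * (k : ℝ) * ((k + 1) * kappa k n)) := by simp
      _ ≤ k * (2 * (k : ℝ) * ((k + 1) * kappa k n)) := by gcongr
      _ = _ := by ring
  refine digits_induction (P := fun N ↦ |eigenSum k (beta k) N| ≤
      (2 * k ^ 2 * (k + 1) + k) * ((k : ℝ) + 1) ^ (Nat.log k N + 1)) hk
    (fun d _ hd ↦ ?_) (fun n d hn hd ih ↦ ?_) hN
  · have h := hblock 0 d hd
    simp only [mul_zero, zero_add, kappa_zero, Int.cast_one, mul_one] at h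
    rw [Nat.log_of_lt hd, zero_add, pow_one, eigenSum]
    refine (Finset.abs_sum_le_sum_abs _ _).trans (h.trans ?_)
    nlinarith [show (0 : ℝ) ≤ (k : ℝ) ^ 2 * (k + 1) by positivity]
  · rw [log_mul_add hk hn hd, eigenSum, Finset.sum_range_add, ← eigenSum,
      eigenSum_mul hk hn (beta_sq k), pow_succ' _ (_ + 1)]
    have h1 := (hblock n d hd)
    have h2 := kappa_le_pow hk hn
    have h3 := Finset.abs_sum_le_sum_abs (fun i ↦ eigenForm k (beta k) (k * n + i))
      (Finset.range d)
    have h4 : |beta k * eigenSum k (beta k) n| ≤ k * |eigenSum k (beta k) n| := by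
      rw [abs_mul]; gcongr; exact abs_beta_le hk
    set P : ℝ := ((k : ℝ) + 1) ^ (Nat.log k n + 1)
    have hP : 1 ≤ P := one_le_pow₀ (by linarith)
    calc _ ≤ k * |eigenSum k (beta k) n| + k + 2 * k ^ 2 * (k + 1) * kappa k n := by
          refine (abs_add_le _ _).trans (add_le_add ?_ (h3.trans h1))
          refine (abs_sub _ _).trans ?_
          rw [Nat.abs_cast]
          linarith
      _ ≤ k * ((2 * k ^ 2 * (k + 1) + k) * P) + k * P + 2 * k ^ 2 * (k + 1) * P := by
          gcongr
          exact le_mul_of_one_le_right (by linarith) hP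
      _ = _ := by ring

/-! ### A summatory function that is exactly homogeneous under `N ↦ k N` -/

/-- The `α`-component of the summatory vector, shifted by a constant for `N ≥ 1` so that
`scaledSum k (k N) = α_k * scaledSum k N` holds without an error term. -/
noncomputable def scaledSum (k N : ℕ) : ℝ :=
  if N = 0 then 0 else eigenSum k (alpha k) N - k / (alpha k - 1)

lemma scaledSum_mul {k : ℕ} (hk : 2 ≤ k) (N : ℕ) :
    scaledSum k (k * N) = alpha k * scaledSum k N := by
  have ha := add_one_lt_alpha hk
  have hk' : (2 : ℝ) ≤ k := by exact_mod_cast hk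
  rcases Nat.eq_zero_or_pos N with rfl | hN
  · simp [scaledSum]
  · have h1 : alpha k - 1 ≠ 0 := by linarith
    rw [scaledSum, scaledSum, if_neg hN.ne', if_neg (by positivity), eigenSum_mul hk hN (alpha_sq k)]
    field_simp
    ring

lemma scaledSum_one_pos {k : ℕ} (hk : 2 ≤ k) : 0 < scaledSum k 1 := by
  have ha := add_one_lt_alpha hk
  have hk' : (2 : ℝ) ≤ k := by exact_mod_cast hk
  have h1 : 0 < alpha k - 1 := by linarith
  have h2 : k / (alpha k - 1) < 1 := by rw [div_lt_one h1]; linarith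
  simp [scaledSum, eigenSum, eigenForm, kappa_zero, lam]
  linarith

lemma eigenForm_alpha_nonneg {k : ℕ} (hk : 2 ≤ k) (n : ℕ) : 0 ≤ eigenForm k (alpha k) n := by
  have ha := add_one_lt_alpha hk
  have h1 := lam_nonneg hk n
  have h2 := one_le_kappa hk n
  have : 0 ≤ alpha k := by linarith [(Nat.cast_nonneg k : (0 : ℝ) ≤ k)]
  unfold eigenForm
  positivity

lemma scaledSum_succ {k N : ℕ} (hN : 0 < N) :
    scaledSum k (N + 1) = scaledSum k N + eigenForm k (alpha k) N := by
  rw [scaledSum, scaledSum, if_neg hN.ne', if_neg (by omega), eigenSum, Finset.sum_range_succ,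
    ← eigenSum]
  ring

lemma monotone_scaledSum {k : ℕ} (hk : 2 ≤ k) : Monotone (scaledSum k) := by
  refine monotone_nat_of_le_succ fun N ↦ ?_
  rcases Nat.eq_zero_or_pos N with rfl | hN
  · simpa [scaledSum] using (scaledSum_one_pos hk).le
  · rw [scaledSum_succ hN]
    linarith [eigenForm_alpha_nonneg hk N]

lemma eigenForm_alpha_le {k : ℕ} (hk : 2 ≤ k) (n : ℕ) :
    eigenForm k (alpha k) n ≤ (alpha k + k) * kappa k n := by
  have h1 := lam_le_kappa hk n
  have hk' : (0 : ℝ) ≤ k := Nat.cast_nonneg k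
  unfold eigenForm
  nlinarith

/-- Appending two zero digits multiplies `κ` by at most `3`. -/
lemma kappa_pow_le {k : ℕ} (hk : 2 ≤ k) (n : ℕ) :
    (kappa k (k ^ (2 * n)) : ℝ) ≤ 2 * 3 ^ n := by
  induction n with
  | zero =>
    have := kappa_mul_add (k := k) hk 0 (i := 1) (by omega)
    norm_num [kappa_zero, lam] at this
    simp [this]
  | succ n ih =>
    have hpos : 0 < k ^ (2 * n) := by positivity
    have h1 := kappa_mul_add (k := k) hk (k ^ (2 * n)) (i := 0) (by omega)
    have h2 := kappa_mul_add (k := k) hk (k * k ^ (2 * n)) (i := 0) (by omega)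
    have h3 := lam_mul_add (k := k) (k ^ (2 * n)) (i := 0) (by omega) (by positivity)
    have h4 := lam_le_kappa hk (k ^ (2 * n))
    have h5 : k ^ (2 * (n + 1)) = k * (k * k ^ (2 * n)) := by ring
    simp only [add_zero, Nat.cast_zero, zero_add, one_mul] at h1 h2 h3
    rw [h5, h2, h3, h1, pow_succ]
    linarith

/-- Up to the factor `α - β`, the summatory function of `κ` is `scaledSum` with a lower order
error. -/
lemma abs_sum_kappa_sub_le {k N : ℕ} (hk : 2 ≤ k) (hN : 0 < N) :
    |(alpha k - beta k) * ∑ n ∈ Finset.range N, (kappa k n : ℝ) - scaledSum k N| ≤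
      (2 * k ^ 2 * (k + 1) + k + 1) * ((k : ℝ) + 1) ^ (Nat.log k N + 1) := by
  have hk' : (2 : ℝ) ≤ k := by exact_mod_cast hk
  have ha := add_one_lt_alpha hk
  have h1 : (alpha k - beta k) * ∑ n ∈ Finset.range N, (kappa k n : ℝ) - scaledSum k N =
      k / (alpha k - 1) - eigenSum k (beta k) N := by
    rw [scaledSum, if_neg hN.ne']
    simp only [eigenSum, eigenForm, Finset.sum_add_distrib, ← Finset.mul_sum]
    ring
  have h2 : |(k : ℝ) / (alpha k - 1)| ≤ 1 := by
    have h0 : 0 < alpha k - 1 := by linarith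
    rw [abs_of_nonneg (by positivity), div_le_one h0]
    linarith
  have h3 := abs_eigenSum_beta_le hk hN
  have h4 : (1 : ℝ) ≤ ((k : ℝ) + 1) ^ (Nat.log k N + 1) := one_le_pow₀ (by linarith)
  rw [h1]
  refine (abs_sub _ _).trans ?_
  linarith

/-! ### Extending a homogeneous sequence to the half-line -/

/-- For a monotone sequence with `f (k N) = a f N`, the extension of `f` to a monotone function on
`(0, ∞)` with `g (k x) = a g x`, obtained by approximating `x` from above by `k`-adic rationals. -/
noncomputable def homogExt (k : ℕ) (a : ℝ) (f : ℕ → ℝ) (x : ℝ) : ℝ :=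
  ⨅ n : ℕ, f ⌈x * k ^ n⌉₊ / a ^ n

section homogExt

variable {k : ℕ} {a : ℝ} {f : ℕ → ℝ}

lemma homogSeq_zero (ha : 1 < a) (hf : ∀ N, f (k * N) = a * f N) : f 0 = 0 := by
  have := hf 0
  rw [mul_zero] at this
  nlinarith

lemma homogSeq_nonneg (ha : 1 < a) (hmono : Monotone f) (hf : ∀ N, f (k * N) = a * f N) (N : ℕ) :
    0 ≤ f N :=
  (homogSeq_zero ha hf).symm.le.trans (hmono (Nat.zero_le N))

lemma homogSeq_pow_mul (hf : ∀ N, f (k * N) = a * f N) (n N : ℕ) :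
    f (k ^ n * N) = a ^ n * f N := by
  induction n with
  | zero => simp
  | succ n ih => rw [pow_succ', mul_assoc, hf, ih, pow_succ', mul_assoc]

lemma antitone_homogExt_approx (ha : 1 < a) (hmono : Monotone f)
    (hf : ∀ N, f (k * N) = a * f N) (x : ℝ) :
    Antitone fun n : ℕ ↦ f ⌈x * k ^ n⌉₊ / a ^ n := by
  refine antitone_nat_of_succ_le fun n ↦ ?_
  have ha0 : 0 < a := by linarith
  rw [div_le_div_iff₀ (by positivity) (by positivity)]
  have h1 : ⌈x * (k : ℝ) ^ (n + 1)⌉₊ ≤ k * ⌈x * (k : ℝ) ^ n⌉₊ := by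
    rw [Nat.ceil_le]
    push_cast
    calc x * (k : ℝ) ^ (n + 1) = k * (x * k ^ n) := by ring
      _ ≤ _ := by gcongr; exact Nat.le_ceil _
  have h2 := hmono h1
  rw [hf] at h2
  calc _ ≤ a * f ⌈x * (k : ℝ) ^ n⌉₊ * a ^ n := by gcongr
    _ = _ := by ring

lemma bddBelow_homogExt_approx (ha : 1 < a) (hmono : Monotone f)
    (hf : ∀ N, f (k * N) = a * f N) (x : ℝ) :
    BddBelow (range fun n : ℕ ↦ f ⌈x * k ^ n⌉₊ / a ^ n) := by
  refine ⟨0, ?_⟩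
  rintro _ ⟨n, rfl⟩
  have := homogSeq_nonneg ha hmono hf ⌈x * (k : ℝ) ^ n⌉₊
  have ha0 : 0 < a := by linarith
  positivity

lemma tendsto_homogExt (ha : 1 < a) (hmono : Monotone f) (hf : ∀ N, f (k * N) = a * f N) (x : ℝ) :
    Tendsto (fun n : ℕ ↦ f ⌈x * k ^ n⌉₊ / a ^ n) atTop (𝓝 (homogExt k a f x)) :=
  tendsto_atTop_ciInf (antitone_homogExt_approx ha hmono hf x)
    (bddBelow_homogExt_approx ha hmono hf x)

lemma monotone_homogExt (ha : 1 < a) (hmono : Monotone f) (hf : ∀ N, f (k * N) = a * f N) :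
    Monotone (homogExt k a f) := by
  intro x y hxy
  refine ciInf_mono (bddBelow_homogExt_approx ha hmono hf x) fun n ↦ ?_
  have ha0 : 0 < a := by linarith
  gcongr
  exact hmono (Nat.ceil_mono (by gcongr))

lemma homogExt_natCast (ha : 1 < a) (hf : ∀ N, f (k * N) = a * f N) (N : ℕ) :
    homogExt k a f N = f N := by
  have h : ∀ n : ℕ, f ⌈(N : ℝ) * k ^ n⌉₊ / a ^ n = f N := by
    intro n
    have h1 : ⌈(N : ℝ) * k ^ n⌉₊ = k ^ n * N := by
      rw [← Nat.cast_pow, ← Nat.cast_mul, Nat.ceil_natCast, mul_comm]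
    rw [h1, homogSeq_pow_mul hf]
    have : a ^ n ≠ 0 := pow_ne_zero _ (by linarith)
    field_simp
  simp only [homogExt, h, ciInf_const]

lemma homogExt_mul (ha : 1 < a) (hmono : Monotone f) (hf : ∀ N, f (k * N) = a * f N) (x : ℝ) :
    homogExt k a f (k * x) = a * homogExt k a f x := by
  refine tendsto_nhds_unique (tendsto_homogExt ha hmono hf (k * x)) ?_
  have h := ((tendsto_homogExt ha hmono hf x).comp (tendsto_add_atTop_nat 1)).const_mul a
  refine h.congr fun n ↦ ?_
  have : a ≠ 0 := by linarith
  have h1 : x * (k : ℝ) ^ (n + 1) = k * x * k ^ n := by ring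
  rw [Function.comp_apply, h1, pow_succ]
  field_simp

lemma homogExt_zpow (hk : 2 ≤ k) (ha : 1 < a) (hmono : Monotone f)
    (hf : ∀ N, f (k * N) = a * f N) (j : ℤ) :
    homogExt k a f ((k : ℝ) ^ j) = a ^ j * f 1 := by
  have ha0 : a ≠ 0 := by linarith
  have hk0 : (k : ℝ) ≠ 0 := by positivity
  induction j with
  | zero => simpa using homogExt_natCast ha hf 1
  | succ i ih => rw [zpow_add_one₀ hk0, mul_comm, homogExt_mul ha hmono hf, ih,
      zpow_add_one₀ ha0]; ring
  | pred i ih =>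
    have h := homogExt_mul ha hmono hf ((k : ℝ) ^ (-(i : ℤ) - 1))
    rw [mul_comm, ← zpow_add_one₀ hk0, sub_add_cancel, ih] at h
    rw [zpow_sub_one₀ ha0]
    field_simp
    linarith

lemma zpow_rpow_logb (hk : 2 ≤ k) (ha : 1 < a) (j : ℤ) :
    ((k : ℝ) ^ j) ^ Real.logb k a = a ^ j := by
  have hk' : (2 : ℝ) ≤ k := by exact_mod_cast hk
  rw [← Real.rpow_intCast, ← Real.rpow_mul (by linarith), mul_comm, Real.rpow_mul (by linarith),
    Real.rpow_logb (by linarith) (by linarith) (by linarith), Real.rpow_intCast]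

/-- The homogeneity pins the order of growth: `homogExt` is of the exact order `x ^ log_k a`. -/
lemma homogExt_bounds (hk : 2 ≤ k) (ha : 1 < a) (hmono : Monotone f)
    (hf : ∀ N, f (k * N) = a * f N) (hf1 : 0 < f 1) {x : ℝ} (hx : 0 < x) :
    f 1 / a * x ^ Real.logb k a ≤ homogExt k a f x ∧
      homogExt k a f x ≤ a * f 1 * x ^ Real.logb k a := by
  have hk' : (1 : ℝ) < k := by exact_mod_cast hk
  have ha0 : 0 < a := by linarith
  have hs : 0 ≤ Real.logb k a := Real.logb_nonneg hk' ha.le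
  obtain ⟨j, hj1, hj2⟩ := exists_mem_Ico_zpow hx hk'
  have h1 := monotone_homogExt ha hmono hf hj1
  have h2 := monotone_homogExt ha hmono hf hj2.le
  rw [homogExt_zpow hk ha hmono hf] at h1 h2
  have h3 := Real.rpow_le_rpow (by positivity) hj1 hs
  have h4 := Real.rpow_le_rpow hx.le hj2.le hs
  rw [zpow_rpow_logb hk ha] at h3 h4
  rw [zpow_add_one₀ ha0.ne'] at h2 h4
  constructor
  · calc _ ≤ f 1 / a * (a ^ j * a) := by gcongr
      _ = a ^ j * f 1 := by field_simp
      _ ≤ _ := h1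
  · calc _ ≤ a ^ j * a * f 1 := h2
      _ = a * f 1 * a ^ j := by ring
      _ ≤ _ := by gcongr

end homogExt

/-! ### Comparison of the summatory function of `κ` with its homogeneous model -/

/-- The monotone function, exactly homogeneous under `x ↦ k x`, to which the summatory function of
`κ` is asymptotic. -/
noncomputable def sumModel (k : ℕ) (x : ℝ) : ℝ :=
  homogExt k (alpha k) (scaledSum k) x / (alpha k - beta k)

/-- The exponent `log_k α_k`. -/
noncomputable def expo (k : ℕ) : ℝ := Real.logb k (alpha k)

section sumModel

variable {k : ℕ}

lemma alpha_sub_beta_pos (hk : 2 ≤ k) : 0 < alpha k - beta k := by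
  have hk' : (2 : ℝ) ≤ k := by exact_mod_cast hk
  have := lt_alpha hk
  unfold beta
  nlinarith

lemma one_lt_alpha (hk : 2 ≤ k) : 1 < alpha k := by
  have hk' : (2 : ℝ) ≤ k := by exact_mod_cast hk
  linarith [add_one_lt_alpha hk]

lemma one_le_expo (hk : 2 ≤ k) : 1 ≤ expo k := by
  have hk' : (2 : ℝ) ≤ k := by exact_mod_cast hk
  have h := two_mul_le_alpha hk
  rw [expo, Real.le_logb_iff_rpow_le (by linarith) (by linarith), Real.rpow_one]
  linarith

lemma rpow_expo (hk : 2 ≤ k) : (k : ℝ) ^ expo k = alpha k := by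
  simpa [expo] using zpow_rpow_logb hk (one_lt_alpha hk) 1

lemma monotone_sumModel (hk : 2 ≤ k) : Monotone (sumModel k) := fun x y hxy ↦ by
  have h := alpha_sub_beta_pos hk
  unfold sumModel
  gcongr
  exact monotone_homogExt (one_lt_alpha hk) (monotone_scaledSum hk) (scaledSum_mul hk) hxy

lemma sumModel_mul (hk : 2 ≤ k) (x : ℝ) : sumModel k (k * x) = alpha k * sumModel k x := by
  rw [sumModel, sumModel,
    homogExt_mul (one_lt_alpha hk) (monotone_scaledSum hk) (scaledSum_mul hk), mul_div_assoc]

lemma sumModel_natCast (hk : 2 ≤ k) (N : ℕ) :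
    sumModel k N = scaledSum k N / (alpha k - beta k) := by
  rw [sumModel, homogExt_natCast (one_lt_alpha hk) (scaledSum_mul hk)]

lemma sumModel_bounds (hk : 2 ≤ k) : ∃ c₁ c₂ : ℝ, 0 < c₁ ∧ ∀ x, 0 < x →
    c₁ * x ^ expo k ≤ sumModel k x ∧ sumModel k x ≤ c₂ * x ^ expo k := by
  have h := alpha_sub_beta_pos hk
  have h1 := scaledSum_one_pos hk
  have ha := one_lt_alpha hk
  refine ⟨scaledSum k 1 / alpha k / (alpha k - beta k),
    alpha k * scaledSum k 1 / (alpha k - beta k), by positivity, fun x hx ↦ ?_⟩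
  obtain ⟨h2, h3⟩ := homogExt_bounds hk ha (monotone_scaledSum hk) (scaledSum_mul hk) h1 hx
  rw [sumModel, div_mul_eq_mul_div, div_mul_eq_mul_div _ (alpha k - beta k)]
  constructor <;> gcongr
  exacts [h2, h3]

/-- The summatory function of `κ` as a step function of a real variable. -/
noncomputable def sumKappa (k : ℕ) (x : ℝ) : ℝ :=
  ∑ n ∈ Finset.range (⌊x⌋₊ + 1), (kappa k n : ℝ)

lemma monotone_sumKappa (hk : 2 ≤ k) : Monotone (sumKappa k) := fun x y hxy ↦ by
  refine Finset.sum_le_sum_of_subset_of_nonneg ?_ fun n _ _ ↦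
    zero_le_one.trans (one_le_kappa hk n)
  have := Nat.floor_mono hxy
  intro i
  simp only [Finset.mem_range]
  omega

lemma sumModel_sub_le (hk : 2 ≤ k) {x : ℝ} (hx : 1 ≤ x) :
    |(alpha k - beta k) * sumKappa k x - (alpha k - beta k) * sumModel k x| ≤
      (2 * k ^ 2 * (k + 1) + k + 1 + 2 * (alpha k + k)) *
        ((k : ℝ) + 1) ^ (Nat.log k ⌊x⌋₊ + 1) := by
  have hk' : (2 : ℝ) ≤ k := by exact_mod_cast hk
  have ha := one_lt_alpha hk
  have hab := (alpha_sub_beta_pos hk).ne'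
  set N := ⌊x⌋₊ with hN
  have hN0 : 0 < N := Nat.floor_pos.2 hx
  have hmono := monotone_homogExt ha (monotone_scaledSum hk) (scaledSum_mul hk)
  have h1 := hmono (Nat.floor_le (by linarith : 0 ≤ x))
  have h2 := hmono (Nat.lt_floor_add_one x).le
  rw [← hN, homogExt_natCast ha (scaledSum_mul hk)] at h1
  rw [← hN, ← Nat.cast_add_one, homogExt_natCast ha (scaledSum_mul hk)] at h2
  have h3 : (alpha k - beta k) * sumModel k x = homogExt k (alpha k) (scaledSum k) x := by
    rw [sumModel]; field_simp
  have h4 := abs_sum_kappa_sub_le hk hN0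
  have h5 := scaledSum_succ (k := k) hN0
  have h6 := eigenForm_alpha_le hk N
  have h7 := kappa_le_pow hk hN0
  have h8 := one_le_kappa hk N
  have h9 : sumKappa k x = ∑ n ∈ Finset.range N, (kappa k n : ℝ) + kappa k N :=
    Finset.sum_range_succ _ _
  have h10 : alpha k - beta k ≤ alpha k + k := by linarith [abs_le.1 (abs_beta_le hk)]
  set P : ℝ := ((k : ℝ) + 1) ^ (Nat.log k N + 1)
  have h11 : (alpha k - beta k) * kappa k N ≤ (alpha k + k) * P :=
    mul_le_mul h10 h7 (by linarith) (by linarith)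
  have h12 : eigenForm k (alpha k) N ≤ (alpha k + k) * P := h6.trans (by gcongr)
  have h13 : 0 ≤ (alpha k - beta k) * (kappa k N : ℝ) :=
    mul_nonneg (alpha_sub_beta_pos hk).le (by linarith)
  have h14 : 0 ≤ (alpha k + k) * P := h13.trans h11
  rw [h3, h9]
  rw [abs_le] at h4 ⊢
  constructor <;> linarith

lemma tendsto_sumKappa_div (hk : 2 ≤ k) :
    Tendsto (fun x ↦ sumKappa k x / sumModel k x) atTop (𝓝 1) := by
  have hk' : (2 : ℝ) ≤ k := by exact_mod_cast hk
  have ha := one_lt_alpha hk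
  have ha' := add_one_lt_alpha hk
  have hab := alpha_sub_beta_pos hk
  have hf1 := scaledSum_one_pos hk
  set D : ℝ := (2 * k ^ 2 * (k + 1) + k + 1 + 2 * (alpha k + k)) * (k + 1) / scaledSum k 1
  have hlog : Tendsto (fun x : ℝ ↦ Nat.log k ⌊x⌋₊) atTop atTop := by
    refine Tendsto.comp (g := Nat.log k) ?_ tendsto_nat_floor_atTop
    refine tendsto_atTop.2 fun b ↦ ?_
    filter_upwards [eventually_ge_atTop (k ^ b)] with n hn
    exact Nat.le_log_of_pow_le (by omega) hn
  have hlim : Tendsto (fun x : ℝ ↦ D * (((k : ℝ) + 1) / alpha k) ^ Nat.log k ⌊x⌋₊) atTop (𝓝 0) := by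
    have := (tendsto_pow_atTop_nhds_zero_of_lt_one (r := ((k : ℝ) + 1) / alpha k) (by positivity)
      ((div_lt_one (by linarith)).2 ha')).comp hlog
    simpa using this.const_mul D
  rw [tendsto_iff_norm_sub_tendsto_zero]
  refine squeeze_zero' (Eventually.of_forall fun _ ↦ norm_nonneg _) ?_ hlim
  filter_upwards [eventually_ge_atTop 1] with x hx
  have hN0 : 0 < ⌊x⌋₊ := Nat.floor_pos.2 hx
  set N := ⌊x⌋₊ with hN
  set ℓ := Nat.log k N
  have hlow : alpha k ^ ℓ * scaledSum k 1 ≤ (alpha k - beta k) * sumModel k x := by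
    have h1 : (alpha k - beta k) * sumModel k x = homogExt k (alpha k) (scaledSum k) x := by
      rw [sumModel]; field_simp
    rw [h1, ← homogSeq_pow_mul (scaledSum_mul hk), mul_one,
      ← homogExt_natCast ha (scaledSum_mul hk)]
    refine monotone_homogExt ha (monotone_scaledSum hk) (scaledSum_mul hk) ?_
    calc ((k ^ ℓ : ℕ) : ℝ) ≤ N := by exact_mod_cast Nat.pow_log_le_self k hN0.ne'
      _ ≤ x := Nat.floor_le (by linarith)
  have hpos : 0 < alpha k ^ ℓ * scaledSum k 1 := by positivity
  have hM : sumModel k x ≠ 0 := by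
    intro h
    rw [h] at hlow
    linarith
  have hmain := sumModel_sub_le hk hx
  have h2 : sumKappa k x / sumModel k x - 1 =
      ((alpha k - beta k) * sumKappa k x - (alpha k - beta k) * sumModel k x) /
        ((alpha k - beta k) * sumModel k x) := by
    field_simp
  rw [h2, norm_div, Real.norm_eq_abs, Real.norm_eq_abs, abs_of_pos (hpos.trans_le hlow)]
  calc _ ≤ (2 * k ^ 2 * (k + 1) + k + 1 + 2 * (alpha k + k)) *
        ((k : ℝ) + 1) ^ (ℓ + 1) / (alpha k ^ ℓ * scaledSum k 1) := by
        refine div_le_div₀ ?_ hmain hpos hlow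
        positivity
    _ = _ := by
      simp only [D]
      rw [pow_succ, div_pow]
      field_simp
      ring

/-- A pure power `c x ^ log_k α_k` is too regular to be the model: it would grow by at least
`c (α_k / k) ^ n ≥ c 2 ^ n` from `k ^ n` to `k ^ n + 1`, whereas `κ(k ^ n)` only grows like the
Fibonacci numbers. -/
lemma not_sumModel_eq_rpow (hk : 2 ≤ k) (c : ℝ) : ¬ ∀ x, 0 < x → sumModel k x = c * x ^ expo k := by
  intro h
  have hk' : (2 : ℝ) ≤ k := by exact_mod_cast hk
  have ha := one_lt_alpha hk
  have hab := alpha_sub_beta_pos hk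
  have hc : 0 < c := by
    have h1 := h 1 one_pos
    have h2 := sumModel_natCast hk 1
    rw [Nat.cast_one] at h2
    rw [h2, Real.one_rpow, mul_one] at h1
    rw [← h1]
    exact div_pos (scaledSum_one_pos hk) hab
  have key : ∀ n : ℕ, c * 4 ^ n ≤ 2 * (alpha k + k) / (alpha k - beta k) * 3 ^ n := by
    intro n
    set Q : ℕ := k ^ (2 * n)
    have hQ : 0 < Q := by positivity
    have hQ' : (0 : ℝ) < Q := by exact_mod_cast hQ
    have h1 := h (Q : ℝ) hQ'
    have h2 := h ((Q + 1 : ℕ) : ℝ) (by positivity)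
    rw [sumModel_natCast hk] at h1 h2
    have h3 : ((Q + 1 : ℕ) : ℝ) = Q * (1 + (Q : ℝ)⁻¹) := by push_cast; field_simp
    rw [h3, Real.mul_rpow hQ'.le (by positivity), scaledSum_succ hQ, add_div, h1] at h2
    have h4 := one_add_mul_self_le_rpow_one_add (s := (Q : ℝ)⁻¹)
      (by linarith [inv_pos.2 hQ']) (one_le_expo hk)
    have h5 : 1 + (Q : ℝ)⁻¹ ≤ (1 + (Q : ℝ)⁻¹) ^ expo k :=
      le_trans (by gcongr; exact le_mul_of_one_le_left (by positivity) (one_le_expo hk)) h4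
    have h6 : (Q : ℝ) ^ expo k = alpha k ^ (2 * n) := by
      have := zpow_rpow_logb hk ha ((2 * n : ℕ) : ℤ)
      simpa only [zpow_natCast, Q, Nat.cast_pow, expo] using this
    have h7 : c * (alpha k ^ (2 * n) * (Q : ℝ)⁻¹) ≤
        eigenForm k (alpha k) Q / (alpha k - beta k) := by
      have : c * (alpha k ^ (2 * n) * (1 + (Q : ℝ)⁻¹)) ≤
          c * ((Q : ℝ) ^ expo k * (1 + (Q : ℝ)⁻¹) ^ expo k) := by
        rw [h6]; gcongr
      rw [h6] at this h2
      nlinarith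
    have h8 : (4 : ℝ) ^ n ≤ alpha k ^ (2 * n) * (Q : ℝ)⁻¹ := by
      have h9 : (2 : ℝ) ≤ alpha k / k := by
        rw [le_div_iff₀ (by linarith)]; exact two_mul_le_alpha hk
      calc (4 : ℝ) ^ n = 2 ^ (2 * n) := by rw [pow_mul]; norm_num
        _ ≤ (alpha k / k) ^ (2 * n) := by gcongr
        _ = _ := by rw [div_pow, Nat.cast_pow, div_eq_mul_inv]
    calc c * 4 ^ n ≤ c * (alpha k ^ (2 * n) * (Q : ℝ)⁻¹) := by gcongr
      _ ≤ _ := h7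
      _ ≤ (alpha k + k) * (2 * 3 ^ n) / (alpha k - beta k) := by
        gcongr
        refine (eigenForm_alpha_le hk Q).trans ?_
        gcongr
        exact kappa_pow_le hk n
      _ = _ := by ring
  have hlim : Tendsto (fun n : ℕ ↦ (4 / 3 : ℝ) ^ n) atTop atTop :=
    tendsto_pow_atTop_atTop_of_one_lt (by norm_num)
  obtain ⟨n, hn⟩ := (hlim.eventually_gt_atTop
    (2 * (alpha k + k) / (alpha k - beta k) / c)).exists
  rw [div_lt_iff₀ hc, div_pow, div_mul_eq_mul_div, lt_div_iff₀ (by positivity)] at hn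
  linarith [key n]

end sumModel

open MeasureTheory ProbabilityTheory

/-! ### Laplace transforms of functions of power order -/

/-- The Laplace transform `∫₀^∞ e^{-tx} g(x) dx`. -/
noncomputable def laplace (g : ℝ → ℝ) (t : ℝ) : ℝ := ∫ x in Ioi (0 : ℝ), Real.exp (-(t * x)) * g x

/-- `g` is measurable and of exact order `x ^ s` on the whole half-line `(0, ∞)`. -/
def HasPowerOrder (s : ℝ) (g : ℝ → ℝ) : Prop :=
  Measurable g ∧ ∃ c₁ c₂ : ℝ, 0 < c₁ ∧ ∀ x, 0 < x → c₁ * x ^ s ≤ g x ∧ g x ≤ c₂ * x ^ s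

section laplace

variable {s : ℝ} {g h : ℝ → ℝ}

lemma HasPowerOrder.pos (hg : HasPowerOrder s g) {x : ℝ} (hx : 0 < x) : 0 < g x := by
  obtain ⟨-, c₁, c₂, hc, hb⟩ := hg
  exact (mul_pos hc (Real.rpow_pos_of_pos hx s)).trans_le (hb x hx).1

lemma integrableOn_exp_mul_rpow (hs : 0 ≤ s) {t : ℝ} (ht : 0 < t) :
    IntegrableOn (fun x : ℝ ↦ Real.exp (-(t * x)) * x ^ s) (Ioi 0) := by
  have h := integrableOn_rpow_mul_exp_neg_mul_rpow (s := s) (p := 1) (by linarith) one_pos ht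
  refine h.congr_fun (fun x _ ↦ ?_) measurableSet_Ioi
  simp only [Real.rpow_one]
  rw [mul_comm, neg_mul]

lemma integral_exp_mul_rpow (hs : 0 ≤ s) {t : ℝ} (ht : 0 < t) :
    ∫ x in Ioi (0 : ℝ), Real.exp (-(t * x)) * x ^ s = (t ^ (s + 1))⁻¹ * Real.Gamma (s + 1) := by
  have h := Real.integral_rpow_mul_exp_neg_mul_Ioi (a := s + 1) (by linarith) ht
  rw [add_sub_cancel_right, one_div, Real.inv_rpow ht.le] at h
  rw [← h]
  simp only [mul_comm]

lemma HasPowerOrder.integrableOn (hg : HasPowerOrder s g) (hs : 0 ≤ s) {t : ℝ} (ht : 0 < t) :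
    IntegrableOn (fun x ↦ Real.exp (-(t * x)) * g x) (Ioi 0) := by
  obtain ⟨hm, c₁, c₂, hc, hb⟩ := hg
  refine ((integrableOn_exp_mul_rpow hs ht).const_mul c₂).mono' ?_ ?_
  · exact Measurable.aestronglyMeasurable (by fun_prop)
  · filter_upwards [ae_restrict_mem measurableSet_Ioi] with x hx
    have hx' : (0 : ℝ) < x := hx
    obtain ⟨h1, h2⟩ := hb x hx'
    have h3 : 0 ≤ g x := le_trans (by positivity) h1
    rw [Real.norm_eq_abs, abs_of_nonneg (by positivity)]
    calc _ ≤ Real.exp (-(t * x)) * (c₂ * x ^ s) := by gcongr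
      _ = _ := by ring

lemma HasPowerOrder.laplace_bounds (hg : HasPowerOrder s g) (hs : 0 ≤ s) :
    ∃ c₁ c₂ : ℝ, 0 < c₁ ∧ ∀ t, 0 < t →
      c₁ ≤ t ^ (s + 1) * laplace g t ∧ t ^ (s + 1) * laplace g t ≤ c₂ := by
  have hg' := hg
  obtain ⟨hm, c₁, c₂, hc, hb⟩ := hg
  have hG : 0 < Real.Gamma (s + 1) := Real.Gamma_pos_of_pos (by linarith)
  refine ⟨c₁ * Real.Gamma (s + 1), c₂ * Real.Gamma (s + 1), by positivity, fun t ht ↦ ?_⟩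
  have hpow : 0 < t ^ (s + 1) := Real.rpow_pos_of_pos ht _
  have hval : ∀ c : ℝ, ∫ x in Ioi (0 : ℝ), c * (Real.exp (-(t * x)) * x ^ s) =
      c * ((t ^ (s + 1))⁻¹ * Real.Gamma (s + 1)) := fun c ↦ by
    rw [integral_const_mul, integral_exp_mul_rpow hs ht]
  have hcancel : ∀ c : ℝ, t ^ (s + 1) * (c * ((t ^ (s + 1))⁻¹ * Real.Gamma (s + 1))) =
      c * Real.Gamma (s + 1) := fun c ↦ by field_simp
  rw [← hcancel c₁, ← hcancel c₂, ← hval c₁, ← hval c₂]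
  constructor
  · refine mul_le_mul_of_nonneg_left (setIntegral_mono_on
      ((integrableOn_exp_mul_rpow hs ht).const_mul c₁) (hg'.integrableOn hs ht) measurableSet_Ioi
      fun x hx ↦ ?_) hpow.le
    nlinarith [(hb x hx).1, Real.exp_pos (-(t * x))]
  · refine mul_le_mul_of_nonneg_left (setIntegral_mono_on (hg'.integrableOn hs ht)
      ((integrableOn_exp_mul_rpow hs ht).const_mul c₂) measurableSet_Ioi
      fun x hx ↦ ?_) hpow.le
    nlinarith [(hb x hx).2, Real.exp_pos (-(t * x))]

lemma HasPowerOrder.laplace_pos (hg : HasPowerOrder s g) (hs : 0 ≤ s) {t : ℝ} (ht : 0 < t) :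
    0 < laplace g t := by
  obtain ⟨c₁, c₂, hc, hb⟩ := hg.laplace_bounds hs
  exact pos_of_mul_pos_right (hc.trans_le (hb t ht).1) (Real.rpow_pos_of_pos ht _).le

lemma laplace_mul {k a : ℝ} (hk : 0 < k) (ha : a ≠ 0) (hg : ∀ x, g (k * x) = a * g x) (t : ℝ) :
    laplace g (k * t) = (k * a)⁻¹ * laplace g t := by
  have h := integral_comp_mul_left_Ioi (fun y ↦ Real.exp (-(t * y)) * (a⁻¹ * g y)) 0 hk
  simp only [hg, mul_zero, smul_eq_mul] at h
  have h1 : laplace g (k * t) =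
      ∫ x in Ioi (0 : ℝ), Real.exp (-(t * (k * x))) * (a⁻¹ * (a * g x)) := by
    refine integral_congr_ae (Eventually.of_forall fun x ↦ ?_)
    simp only
    rw [inv_mul_cancel_left₀ ha]
    ring_nf
  rw [h1, h, laplace, mul_inv, mul_assoc, ← integral_const_mul a⁻¹]
  congr 2
  ext x
  ring

/-- The measure with density `g` on `(0, ∞)`; its moment generating function at `-t` is the
Laplace transform of `g` at `t`. -/
noncomputable def halfLineMeasure (g : ℝ → ℝ) : Measure ℝ :=
  (volume.restrict (Ioi (0 : ℝ))).withDensity fun x ↦ ENNReal.ofReal (g x)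

lemma mgf_halfLineMeasure (hm : Measurable g) (hg : ∀ x, 0 < x → 0 ≤ g x) (t : ℝ) :
    mgf id (halfLineMeasure g) t = ∫ x in Ioi (0 : ℝ), Real.exp (t * x) * g x := by
  rw [mgf, halfLineMeasure, integral_withDensity_eq_integral_toReal_smul (by fun_prop)
    (Eventually.of_forall fun _ ↦ ENNReal.ofReal_lt_top)]
  refine setIntegral_congr_fun measurableSet_Ioi fun x hx ↦ ?_
  simp only [id, smul_eq_mul]
  rw [ENNReal.toReal_ofReal (hg x hx), mul_comm]

lemma mem_integrableExpSet_halfLineMeasure (hm : Measurable g) (hg : ∀ x, 0 < x → 0 ≤ g x)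
    (t : ℝ) : t ∈ integrableExpSet id (halfLineMeasure g) ↔
      IntegrableOn (fun x ↦ Real.exp (t * x) * g x) (Ioi 0) := by
  rw [integrableExpSet, Set.mem_ofPred_eq, halfLineMeasure,
    integrable_withDensity_iff_integrable_smul' (by fun_prop)
    (Eventually.of_forall fun _ ↦ ENNReal.ofReal_lt_top)]
  refine integrableOn_congr_fun (fun x hx ↦ ?_) measurableSet_Ioi
  simp only [id, smul_eq_mul]
  rw [ENNReal.toReal_ofReal (hg x hx), mul_comm]

lemma HasPowerOrder.analyticOnNhd_laplace (hg : HasPowerOrder s g) (hs : 0 ≤ s) :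
    AnalyticOnNhd ℝ (laplace g) (Ioi 0) := by
  have hnn : ∀ x, 0 < x → 0 ≤ g x := fun x hx ↦ (hg.pos hx).le
  have hsub : Iio (0 : ℝ) ⊆ interior (integrableExpSet id (halfLineMeasure g)) := by
    refine interior_maximal (fun t ht ↦ ?_) isOpen_Iio
    rw [mem_integrableExpSet_halfLineMeasure hg.1 hnn]
    have := hg.integrableOn hs (t := -t) (neg_pos.2 ht)
    simpa only [neg_mul, neg_neg] using this
  have h : laplace g = mgf id (halfLineMeasure g) ∘ fun t ↦ -t := by
    ext t
    rw [Function.comp_apply, mgf_halfLineMeasure hg.1 hnn, laplace]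
    simp only [neg_mul]
  intro t ht
  rw [h]
  have ht' : -t ∈ Iio (0 : ℝ) := neg_lt_zero.2 (mem_Ioi.1 ht)
  exact (analyticAt_mgf (hsub ht')).comp analyticAt_id.neg

lemma HasPowerOrder.not_integrableOn (hg : HasPowerOrder s g) (hs : 0 ≤ s) {t : ℝ} (ht : 0 ≤ t) :
    ¬ IntegrableOn (fun x ↦ Real.exp (t * x) * g x) (Ioi 0) := by
  obtain ⟨hm, c₁, c₂, hc, hb⟩ := hg
  intro h
  have h1 : IntegrableOn (fun _ : ℝ ↦ c₁) (Ioi 1) := by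
    refine (h.mono_set (Ioi_subset_Ioi zero_le_one)).mono' aestronglyMeasurable_const ?_
    filter_upwards [ae_restrict_mem measurableSet_Ioi] with x hx
    have hx1 : (1 : ℝ) < x := hx
    have hx0 : 0 < x := by linarith
    have h2 := (hb x hx0).1
    have h3 : 1 ≤ x ^ s := Real.one_le_rpow hx1.le hs
    have h4 : 1 ≤ Real.exp (t * x) := Real.one_le_exp (by positivity)
    rw [Real.norm_eq_abs, abs_of_pos hc]
    have h5 : c₁ ≤ g x := by nlinarith
    nlinarith
  rw [integrableOn_const_iff] at h1
  simp [hc.ne'] at h1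

/-- Uniqueness for the Laplace transform. After multiplication by `e^{-x}` the two measures are
finite and their moment generating functions are finite exactly on `(-∞, 1)`, so that the
characteristic functions agree. -/
lemma ae_eq_of_laplace_eq (hg : HasPowerOrder s g) (hh : HasPowerOrder s h) (hs : 0 ≤ s)
    (heq : ∀ t, 0 < t → laplace g t = laplace h t) :
    g =ᵐ[volume.restrict (Ioi (0 : ℝ))] h := by
  let w : (ℝ → ℝ) → ℝ → ℝ := fun u x ↦ Real.exp (-x) * u x
  have hexp : ∀ (u : ℝ → ℝ) (t x : ℝ),
      Real.exp (t * x) * w u x = Real.exp (-((1 - t) * x)) * u x := by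
    intro u t x
    rw [← mul_assoc, ← Real.exp_add]
    ring_nf
  have hexp' : ∀ (u : ℝ → ℝ) (t x : ℝ),
      Real.exp (t * x) * w u x = Real.exp ((t - 1) * x) * u x := by
    intro u t x
    rw [← mul_assoc, ← Real.exp_add]
    ring_nf
  have hwm : ∀ u, HasPowerOrder s u → Measurable (w u) := fun u hu ↦ by
    have := hu.1
    fun_prop
  have hwn : ∀ u, HasPowerOrder s u → ∀ x, 0 < x → 0 ≤ w u x := fun u hu x hx ↦
    mul_nonneg (Real.exp_pos _).le (hu.pos hx).le
  have hset : ∀ u, HasPowerOrder s u → integrableExpSet id (halfLineMeasure (w u)) = Iio 1 := by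
    intro u hu
    ext t
    rw [mem_integrableExpSet_halfLineMeasure (hwm u hu) (hwn u hu), mem_Iio]
    constructor
    · intro hi
      by_contra! ht
      simp only [hexp'] at hi
      exact hu.not_integrableOn hs (sub_nonneg.2 ht) hi
    · intro ht
      simp only [hexp]
      exact hu.integrableOn hs (sub_pos.2 ht)
  have hfin : ∀ u, HasPowerOrder s u → IsFiniteMeasure (halfLineMeasure (w u)) := by
    intro u hu
    refine isFiniteMeasure_withDensity_ofReal (Integrable.hasFiniteIntegral ?_)
    have := hu.integrableOn hs one_pos
    simpa only [one_mul, IntegrableOn] using this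
  have hmgf : mgf id (halfLineMeasure (w g)) = mgf id (halfLineMeasure (w h)) := by
    ext t
    by_cases ht : t < 1
    · rw [mgf_halfLineMeasure (hwm g hg) (hwn g hg), mgf_halfLineMeasure (hwm h hh) (hwn h hh)]
      simp only [hexp]
      exact heq _ (sub_pos.2 ht)
    · have h1 : t ∉ integrableExpSet id (halfLineMeasure (w g)) := by rw [hset g hg]; exact ht
      have h2 : t ∉ integrableExpSet id (halfLineMeasure (w h)) := by rw [hset h hh]; exact ht
      rw [mgf_undef h1, mgf_undef h2]
  have hne : ∀ u, HasPowerOrder s u → halfLineMeasure (w u) ≠ 0 := by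
    intro u hu h0
    have h1 : (2 : ℝ) ∈ integrableExpSet id (halfLineMeasure (w u)) := by
      simp [h0, integrableExpSet]
    rw [hset u hu, mem_Iio] at h1
    norm_num at h1
  have h_eqOn := eqOn_complexMGF_of_mgf' hmgf (iff_of_false (hne g hg) (hne h hh))
  have := hfin g hg
  have := hfin h hh
  have hmeas : halfLineMeasure (w g) = halfLineMeasure (w h) := by
    refine Measure.ext_of_charFun ?_
    ext t
    rw [← complexMGF_id_mul_I, ← complexMGF_id_mul_I]
    refine h_eqOn ?_
    simp [hset g hg]
  have hwg := hwm g hg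
  have hwh := hwm h hh
  rw [halfLineMeasure, halfLineMeasure, withDensity_eq_iff_of_sigmaFinite
    (by fun_prop) (by fun_prop)] at hmeas
  filter_upwards [hmeas, ae_restrict_mem measurableSet_Ioi] with x hx hx0
  rw [ENNReal.ofReal_eq_ofReal_iff (hwn g hg x hx0) (hwn h hh x hx0)] at hx
  exact mul_left_cancel₀ (Real.exp_pos (-x)).ne' hx

/-- A monotone function that agrees almost everywhere with a continuous one agrees everywhere. -/
lemma eq_of_ae_eq_of_monotone (hg : Monotone g) (hh : ContinuousOn h (Ioi 0))
    (heq : g =ᵐ[volume.restrict (Ioi (0 : ℝ))] h) {x : ℝ} (hx : 0 < x) : g x = h x := by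
  have hcont : ContinuousAt h x := hh.continuousAt (Ioi_mem_nhds hx)
  have hae : ∀ᵐ y ∂volume, y ∈ Ioi (0 : ℝ) → g y = h y := (ae_restrict_iff' measurableSet_Ioi).1 heq
  have hex : ∀ a b : ℝ, 0 < a → a < b → ∃ y ∈ Ioo a b, g y = h y := by
    intro a b ha hab
    by_contra! hcon
    have h1 : volume (Ioo a b) = 0 := by
      refine measure_mono_null (fun y hy ↦ ?_) (ae_iff.1 hae)
      simp only [Set.mem_ofPred_eq, Classical.not_imp]
      exact ⟨ha.trans hy.1, hcon y hy⟩
    rw [Real.volume_Ioo, ENNReal.ofReal_eq_zero] at h1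
    linarith
  refine le_antisymm (le_of_forall_pos_le_add fun ε hε ↦ ?_)
    (le_of_forall_pos_le_add fun ε hε ↦ ?_)
  all_goals
    obtain ⟨δ, hδ, hball⟩ := Metric.continuousAt_iff.1 hcont ε hε
  · obtain ⟨y, hy, hyeq⟩ := hex x (x + δ) hx (by linarith)
    have h1 := hball (x := y) (by rw [Real.dist_eq, abs_lt]; constructor <;> linarith [hy.1, hy.2])
    rw [Real.dist_eq, abs_lt] at h1
    linarith [hg hy.1.le]
  · obtain ⟨y, hy, hyeq⟩ := hex (max (x / 2) (x - δ)) x (lt_max_of_lt_left (by linarith))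
      (max_lt (by linarith) (by linarith))
    have h2 := (max_lt_iff.1 hy.1).2
    have h1 := hball (x := y) (by rw [Real.dist_eq, abs_lt]; constructor <;> linarith [hy.2])
    rw [Real.dist_eq, abs_lt] at h1
    linarith [hg hy.2.le]

/-- Abelian theorem: asymptotic equivalence at infinity passes to the Laplace transforms
at `0`. -/
lemma tendsto_laplace_div (hg : HasPowerOrder s g) (hs : 0 < s) (hh : Monotone h)
    (hh0 : ∀ x, 0 ≤ h x) (hgm : Monotone g)
    (hlim : Tendsto (fun x ↦ h x / g x) atTop (𝓝 1)) :
    Tendsto (fun t ↦ laplace h t / laplace g t) (𝓝[>] 0) (𝓝 1) := by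
  -- The difference is at most `ε g` plus a constant.
  have hdiff : ∀ ε > 0, ∃ M, 0 ≤ M ∧ ∀ x, 0 < x → |h x - g x| ≤ ε * g x + M := by
    intro ε hε
    have hev := (Metric.tendsto_nhds.1 hlim ε hε).and (eventually_gt_atTop 0)
    obtain ⟨X, hX⟩ := eventually_atTop.1 hev
    refine ⟨h X + |g X|, by linarith [hh0 X, abs_nonneg (g X)], fun x hx ↦ ?_⟩
    have hgx := hg.pos hx
    rcases le_total X x with hXx | hXx
    · have h1 := (hX x hXx).1
      rw [Real.dist_eq, div_sub_one hgx.ne', abs_div, abs_of_pos hgx, div_lt_iff₀ hgx] at h1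
      linarith [hh0 X, abs_nonneg (g X)]
    · have h1 := hh hXx
      have h2 := hgm hXx
      have h3 := hh0 x
      have h4 := le_abs_self (g X)
      have h5 : 0 ≤ ε * g x := by positivity
      rw [abs_le]
      constructor <;> linarith
  have hconst : ∀ t : ℝ, 0 < t → IntegrableOn (fun x : ℝ ↦ Real.exp (-(t * x))) (Ioi 0) ∧
      ∫ x in Ioi (0 : ℝ), Real.exp (-(t * x)) = t⁻¹ := by
    intro t ht
    have h1 := integrableOn_exp_mul_Ioi (neg_lt_zero.2 ht) 0
    have h2 := integral_exp_mul_Ioi (neg_lt_zero.2 ht) 0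
    simp only [neg_mul] at h1 h2
    refine ⟨h1, ?_⟩
    rw [h2]
    simp [neg_div_neg_eq]
  have hhint : ∀ t : ℝ, 0 < t → IntegrableOn (fun x ↦ Real.exp (-(t * x)) * h x) (Ioi 0) := by
    intro t ht
    obtain ⟨M, hM, hb⟩ := hdiff 1 one_pos
    have hmaj := ((hg.integrableOn hs.le ht).const_mul 2).add ((hconst t ht).1.const_mul M)
    refine hmaj.mono' ?_ ?_
    · have := hh.measurable
      exact Measurable.aestronglyMeasurable (by fun_prop)
    · filter_upwards [ae_restrict_mem measurableSet_Ioi] with x hx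
      have h1 := (abs_le.1 (hb x hx)).2
      have h2 := Real.exp_pos (-(t * x))
      rw [Real.norm_eq_abs, abs_of_nonneg (mul_nonneg h2.le (hh0 x)), Pi.add_apply]
      nlinarith
  have hlap : ∀ ε > 0, ∃ M, 0 ≤ M ∧ ∀ t, 0 < t →
      |laplace h t - laplace g t| ≤ ε * laplace g t + M * t⁻¹ := by
    intro ε hε
    obtain ⟨M, hM, hb⟩ := hdiff ε hε
    refine ⟨M, hM, fun t ht ↦ ?_⟩
    have hgi := hg.integrableOn hs.le ht
    rw [laplace, laplace, ← integral_sub (hhint t ht) hgi, ← (hconst t ht).2,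
      ← integral_const_mul, ← integral_const_mul,
      ← integral_add (hgi.const_mul ε) ((hconst t ht).1.const_mul M)]
    refine abs_integral_le_integral_abs.trans (setIntegral_mono_on
      ((hhint t ht).sub hgi).abs ((hgi.const_mul ε).add ((hconst t ht).1.const_mul M))
      measurableSet_Ioi fun x hx ↦ ?_)
    rw [← mul_sub, abs_mul, abs_of_pos (Real.exp_pos _)]
    have := hb x hx
    have h2 := Real.exp_pos (-(t * x))
    nlinarith
  obtain ⟨c₁, c₂, hc, hbd⟩ := hg.laplace_bounds hs.le
  rw [Metric.tendsto_nhds]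
  intro ε hε
  obtain ⟨M, hM, hb⟩ := hlap (ε / 2) (by positivity)
  have hsmall : Tendsto (fun t : ℝ ↦ M / c₁ * t ^ s) (𝓝[>] 0) (𝓝 0) := by
    have h1 : Tendsto (fun t : ℝ ↦ t ^ s) (𝓝[>] 0) (𝓝 0) := by
      have := (Real.continuousAt_rpow_const 0 s (Or.inr hs.le)).tendsto
      rw [Real.zero_rpow hs.ne'] at this
      exact this.mono_left nhdsWithin_le_nhds
    simpa using h1.const_mul (M / c₁)
  filter_upwards [hsmall.eventually (gt_mem_nhds (half_pos hε)), self_mem_nhdsWithin] with t ht ht0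
  have ht0' : 0 < t := ht0
  have hlp := hg.laplace_pos hs.le ht0'
  rw [Real.dist_eq, div_sub_one hlp.ne', abs_div, abs_of_pos hlp, div_lt_iff₀ hlp]
  refine (hb t ht0').trans_lt ?_
  have h1 := (hbd t ht0').1
  rw [Real.rpow_add_one ht0'.ne'] at h1
  have h2 : M * t⁻¹ ≤ M / c₁ * t ^ s * laplace g t := by
    have : M * t⁻¹ * c₁ ≤ M * t⁻¹ * (t ^ s * t * laplace g t) := by gcongr
    calc M * t⁻¹ = M * t⁻¹ * c₁ / c₁ := by field_simp
      _ ≤ M * t⁻¹ * (t ^ s * t * laplace g t) / c₁ := by gcongr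
      _ = _ := by field_simp
  nlinarith

end laplace

/-! ### The generating function as a Laplace transform -/

section generating

variable {k : ℕ}

lemma hasPowerOrder_sumModel (hk : 2 ≤ k) : HasPowerOrder (expo k) (sumModel k) :=
  ⟨(monotone_sumModel hk).measurable, sumModel_bounds hk⟩

/-- Summation by parts, in the form `κ(n) e^{-nt} = t ∫_n^∞ κ(n) e^{-tx} dx`. -/
lemma K_exp_neg (hk : 2 ≤ k) {t : ℝ} (ht : 0 < t) :
    K k (Real.exp (-t)) = t * laplace (sumKappa k) t := by
  let F : ℕ → ℝ → ℝ := fun n ↦ (Ici (n : ℝ)).indicator fun x ↦ kappa k n * Real.exp (-(t * x))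
  have hexp := fun c : ℝ ↦ integrableOn_exp_mul_Ioi (neg_lt_zero.2 ht) c
  simp only [neg_mul] at hexp
  have hae : ∀ n : ℕ, (Ioi 0 ∩ Ici (n : ℝ) : Set ℝ) =ᵐ[volume] Ioi (n : ℝ) := fun n ↦ by
    have h1 : (Ioi 0 ∩ Ioi (n : ℝ) : Set ℝ) = Ioi (n : ℝ) := by
      rw [Ioi_inter_Ioi, sup_of_le_right (Nat.cast_nonneg n)]
    have h2 := (ae_eq_refl (Ioi (0 : ℝ))).inter (Ioi_ae_eq_Ici (μ := volume) (a := (n : ℝ)))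
    rw [h1] at h2
    exact h2.symm
  have hint : ∀ n, ∫ x in Ioi (0 : ℝ), F n x = t⁻¹ * (kappa k n * Real.exp (-t) ^ n) := by
    intro n
    have h2 := integral_exp_mul_Ioi (neg_lt_zero.2 ht) n
    simp only [neg_mul] at h2
    rw [setIntegral_indicator measurableSet_Ici, setIntegral_congr_set (hae n),
      integral_const_mul, h2, ← Real.exp_nat_mul, neg_div_neg_eq, mul_neg, mul_comm (n : ℝ)]
    field_simp
  have hFint : ∀ n, Integrable (F n) (volume.restrict (Ioi (0 : ℝ))) := fun n ↦
    Integrable.indicator ((hexp 0).const_mul _) measurableSet_Ici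
  have hFnn : ∀ n x, 0 ≤ F n x := fun n x ↦ indicator_nonneg (fun y _ ↦
    mul_nonneg (zero_le_one.trans (one_le_kappa hk n)) (Real.exp_pos _).le) x
  have hsum : Summable fun n : ℕ ↦ t⁻¹ * (kappa k n * Real.exp (-t) ^ n) := by
    refine (summable_kappa hk ?_).mul_left _
    rw [abs_of_pos (Real.exp_pos _), Real.exp_lt_one_iff]
    linarith
  have hmain := hasSum_integral_of_summable_integral_norm hFint (by
    simpa only [Real.norm_of_nonneg (hFnn _ _), hint] using hsum)
  have htsum : ∀ x ∈ Ioi (0 : ℝ), ∑' n, F n x = Real.exp (-(t * x)) * sumKappa k x := by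
    intro x hx
    rw [tsum_eq_sum (s := Finset.range (⌊x⌋₊ + 1)), sumKappa, Finset.mul_sum]
    · refine Finset.sum_congr rfl fun n hn ↦ ?_
      have h1 : (n : ℝ) ≤ x := (Nat.le_floor_iff (le_of_lt hx)).1
        (Nat.lt_succ_iff.1 (Finset.mem_range.1 hn))
      simp only [F]
      rw [indicator_of_mem (mem_Ici.2 h1), mul_comm]
    · intro n hn
      have h1 : ¬ (n : ℝ) ≤ x := fun h ↦ hn (Finset.mem_range.2
        (Nat.lt_succ_iff.2 (Nat.le_floor h)))
      exact indicator_of_notMem (fun h ↦ h1 (mem_Ici.1 h)) _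
  simp only [hint] at hmain
  rw [setIntegral_congr_fun measurableSet_Ioi htsum] at hmain
  have h3 := (hmain.mul_left t).tsum_eq
  simp only [mul_inv_cancel_left₀ ht.ne'] at h3
  exact h3

/-! ### The oscillating factor -/

/-- The oscillating factor `C(e^{-t}) = t^{s + 1} ∫₀^∞ e^{-tx} g(x) dx`, where `s = log_k α_k` and
`g` is `sumModel`. -/
noncomputable def oscFactor (k : ℕ) (z : ℝ) : ℝ :=
  (-Real.log z) ^ (expo k + 1) * laplace (sumModel k) (-Real.log z)

lemma neg_log_pos {z : ℝ} (hz : z ∈ Ioo (0 : ℝ) 1) : 0 < -Real.log z :=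
  neg_pos.2 (Real.log_neg hz.1 hz.2)

lemma analyticOnNhd_oscFactor (hk : 2 ≤ k) : AnalyticOnNhd ℝ (oscFactor k) (Ioo 0 1) := by
  have hs : 0 ≤ expo k := zero_le_one.trans (one_le_expo hk)
  intro z hz
  have hlog : AnalyticAt ℝ (fun z ↦ -Real.log z) z := (analyticAt_log hz.1).neg
  have hpow : AnalyticAt ℝ (fun z ↦ Real.exp (Real.log (-Real.log z) * (expo k + 1))) z :=
    (((analyticAt_log (neg_log_pos hz)).fun_comp_of_eq hlog rfl).mul analyticAt_const).rexp
  have hlap : AnalyticAt ℝ (fun z ↦ laplace (sumModel k) (-Real.log z)) z :=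
    ((hasPowerOrder_sumModel hk).analyticOnNhd_laplace hs _ (neg_log_pos hz)).fun_comp_of_eq hlog rfl
  refine (hpow.mul hlap).congr ?_
  filter_upwards [Ioo_mem_nhds hz.1 hz.2] with y hy
  simp only [Pi.mul_apply, oscFactor]
  rw [Real.rpow_def_of_pos (neg_log_pos hy)]

/-- `C(e^{-t}) = C(e^{-kt})`, from `g (k x) = α_k g x` and `k ^ s = α_k`. -/
lemma oscFactor_pow (hk : 2 ≤ k) {z : ℝ} (hz : z ∈ Ioo (0 : ℝ) 1) :
    oscFactor k z = oscFactor k (z ^ k) := by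
  have ht := neg_log_pos hz
  have hk0 : (0 : ℝ) < k := by positivity
  have ha : alpha k ≠ 0 := by linarith [one_lt_alpha hk]
  rw [oscFactor, oscFactor, Real.log_pow, ← mul_neg, laplace_mul hk0 ha (sumModel_mul hk),
    Real.mul_rpow hk0.le ht.le, Real.rpow_add_one hk0.ne', rpow_expo hk]
  field_simp

/-- A limit at `1` would force `C` to be constant, hence, by uniqueness of Laplace transforms,
`sumModel` to be a pure power. -/
lemma not_tendsto_oscFactor (hk : 2 ≤ k) : ¬ ∃ L : ℝ, Tendsto (oscFactor k) (𝓝[<] 1) (𝓝 L) := by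
  rintro ⟨L, hL⟩
  have hs : 0 ≤ expo k := zero_le_one.trans (one_le_expo hk)
  have hk1 : (1 : ℝ) < k := by exact_mod_cast hk
  have hG := hasPowerOrder_sumModel hk
  have hroot : ∀ t : ℝ, 0 < t → ∀ n : ℕ,
      oscFactor k (Real.exp (-(t / (k : ℝ) ^ n))) = oscFactor k (Real.exp (-t)) := by
    intro t ht n
    induction n with
    | zero => simp
    | succ n ih =>
      have hpos : 0 < t / (k : ℝ) ^ (n + 1) := by positivity
      rw [← ih, oscFactor_pow hk ⟨Real.exp_pos _, by
        rw [Real.exp_lt_one_iff]; linarith⟩, ← Real.exp_nat_mul]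
      congr 2
      field_simp
      ring
  have hconst : ∀ t : ℝ, 0 < t → oscFactor k (Real.exp (-t)) = L := by
    intro t ht
    have h1 : Tendsto (fun n : ℕ ↦ t / (k : ℝ) ^ n) atTop (𝓝 0) :=
      tendsto_const_nhds.div_atTop (tendsto_pow_atTop_atTop_of_one_lt hk1)
    have h2 : Tendsto (fun n : ℕ ↦ Real.exp (-(t / (k : ℝ) ^ n))) atTop (𝓝[<] 1) := by
      refine tendsto_nhdsWithin_iff.2 ⟨?_, Eventually.of_forall fun n ↦ ?_⟩
      · simpa [Function.comp_def] using (Real.continuous_exp.tendsto _).comp h1.neg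
      · have : 0 < t / (k : ℝ) ^ n := by positivity
        rw [mem_Iio, Real.exp_lt_one_iff]
        linarith
    have h3 := hL.comp h2
    refine tendsto_nhds_unique (tendsto_const_nhds.congr fun n ↦ ?_) h3
    exact (hroot t ht n).symm
  have hLpos : 0 < L := by
    rw [← hconst 1 one_pos]
    simpa [oscFactor] using hG.laplace_pos hs one_pos
  have hGam : 0 < Real.Gamma (expo k + 1) := Real.Gamma_pos_of_pos (by linarith)
  set c := L / Real.Gamma (expo k + 1) with hc
  have hcpos : 0 < c := by positivity
  have hpow : HasPowerOrder (expo k) fun x ↦ c * x ^ expo k :=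
    ⟨by fun_prop, c, c, hcpos, fun x _ ↦ ⟨le_rfl, le_rfl⟩⟩
  have hlap : ∀ t, 0 < t → laplace (sumModel k) t = laplace (fun x ↦ c * x ^ expo k) t := by
    intro t ht
    have h1 := hconst t ht
    have h2 : 0 < t ^ (expo k + 1) := Real.rpow_pos_of_pos ht _
    rw [oscFactor, Real.log_exp, neg_neg] at h1
    have h3 : laplace (fun x ↦ c * x ^ expo k) t =
        c * ((t ^ (expo k + 1))⁻¹ * Real.Gamma (expo k + 1)) := by
      rw [← integral_exp_mul_rpow hs ht, ← integral_const_mul, laplace]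
      congr 1
      ext x
      ring
    rw [h3, hc, ← h1]
    field_simp
  refine not_sumModel_eq_rpow hk c fun x hx ↦ eq_of_ae_eq_of_monotone (monotone_sumModel hk) ?_
    (ae_eq_of_laplace_eq hG hpow hs hlap) hx
  exact continuousOn_const.mul (continuousOn_id.rpow_const fun _ _ ↦ Or.inr hs)

lemma tendsto_one_sub_div_neg_log :
    Tendsto (fun z : ℝ ↦ (1 - z) / -Real.log z) (𝓝[<] 1) (𝓝 1) := by
  have h := (hasDerivAt_iff_tendsto_slope.1 (Real.hasDerivAt_log one_ne_zero)).mono_left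
    (nhdsWithin_mono (1 : ℝ) fun z (hz : z < 1) ↦ hz.ne)
  have h2 := h.inv₀ (by norm_num)
  simp only [inv_one] at h2
  refine h2.congr' ?_
  filter_upwards with z
  rw [slope_def_field, Real.log_one, inv_div, sub_zero, ← neg_sub z 1, neg_div_neg_eq]

/-- With `z = e^{-t}`, the quotient of the two sides is
`(ℒ S / ℒ g)(k ^ m t) * ((1 - z) / t) ^ s`, where `S` is the summatory function of `κ`. -/
lemma isEquivalent_K_pow (hk : 2 ≤ k) (m : ℕ) :
    (fun z : ℝ ↦ K k (z ^ k ^ m)) ~[𝓝[<] 1]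
      (fun z : ℝ ↦ 1 / alpha k ^ m * (oscFactor k z / (1 - z) ^ expo k)) := by
  have hs : 0 < expo k := zero_lt_one.trans_le (one_le_expo hk)
  have hG := hasPowerOrder_sumModel hk
  have hk0 : (0 : ℝ) < k := by positivity
  have ha : 0 < alpha k := zero_lt_one.trans (one_lt_alpha hk)
  have hmem : ∀ᶠ z : ℝ in 𝓝[<] 1, z ∈ Ioo (0 : ℝ) 1 := Ioo_mem_nhdsLT zero_lt_one
  have hlapm : ∀ t, laplace (sumModel k) ((k : ℝ) ^ m * t) =
      ((k : ℝ) ^ m * alpha k ^ m)⁻¹ * laplace (sumModel k) t := by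
    intro t
    refine laplace_mul (by positivity) (by positivity) (fun x ↦ ?_) t
    induction m with
    | zero => simp
    | succ n ih => rw [pow_succ', mul_assoc, sumModel_mul hk, ih, pow_succ', mul_assoc]
  have harg : Tendsto (fun z : ℝ ↦ (k : ℝ) ^ m * -Real.log z) (𝓝[<] 1) (𝓝[>] 0) := by
    refine tendsto_nhdsWithin_iff.2 ⟨?_, hmem.mono fun z hz ↦ ?_⟩
    · have h1 : Tendsto Real.log (𝓝[<] 1) (𝓝 0) := by
        simpa using (Real.continuousAt_log one_ne_zero).tendsto.mono_left nhdsWithin_le_nhds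
      simpa using h1.neg.const_mul ((k : ℝ) ^ m)
    · exact mul_pos (by positivity) (neg_log_pos hz)
  have hA := (tendsto_laplace_div hG hs (monotone_sumKappa hk)
    (fun x ↦ Finset.sum_nonneg fun n _ ↦ zero_le_one.trans (one_le_kappa hk n))
    (monotone_sumModel hk) (tendsto_sumKappa_div hk)).comp harg
  have hB := tendsto_one_sub_div_neg_log.rpow_const (p := expo k) (Or.inl one_ne_zero)
  have hAB := hA.mul hB
  rw [Real.one_rpow, one_mul] at hAB
  refine isEquivalent_of_tendsto_one (hAB.congr' ?_)
  filter_upwards [hmem] with z hz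
  have ht := neg_log_pos hz
  have hz1 : 0 < 1 - z := sub_pos.2 hz.2
  have hKz : K k (z ^ k ^ m) =
      (k : ℝ) ^ m * -Real.log z * laplace (sumKappa k) ((k : ℝ) ^ m * -Real.log z) := by
    rw [← K_exp_neg hk (by positivity)]
    congr 1
    rw [mul_neg, neg_neg, ← Nat.cast_pow, ← Real.log_pow, Real.exp_log (pow_pos hz.1 _)]
  have hlp := hG.laplace_pos hs.le ht
  have hts : 0 < (-Real.log z) ^ expo k := Real.rpow_pos_of_pos ht _
  have hzs : 0 < (1 - z) ^ expo k := Real.rpow_pos_of_pos hz1 _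
  rw [Pi.div_apply, hKz, Function.comp_apply, hlapm, oscFactor, Real.rpow_add_one ht.ne',
    Real.div_rpow hz1.le ht.le]
  generalize laplace (sumKappa k) ((k : ℝ) ^ m * -Real.log z) = S at *
  generalize -Real.log z = t at *
  field_simp

end generating

end Zaremba

theorem mainTheorem3 (k : ℕ) (hk : 2 ≤ k) :
    -- the power series `K` converges on `(-1, 1)`
    (∀ z : ℝ, |z| < 1 → Summable (fun n : ℕ => (Zaremba.kappa k n : ℝ) * z ^ n)) ∧
    ∃ C : ℝ → ℝ,
      -- real-analytic on `(0, 1)`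
      AnalyticOnNhd ℝ C (Ioo 0 1) ∧
      -- bounded away from `0` and `∞`
      (∃ c₁ c₂ : ℝ, 0 < c₁ ∧ ∀ z ∈ Ioo (0 : ℝ) 1, c₁ ≤ C z ∧ C z ≤ c₂) ∧
      -- invariance
      (∀ z ∈ Ioo (0 : ℝ) 1, C z = C (z ^ k)) ∧
      -- oscillatory: no limit as `z → 1⁻`
      (¬ ∃ L : ℝ, Tendsto C (𝓝[<] 1) (𝓝 L)) ∧
      -- the asymptotics, with the same `C` for all `m`
      ∀ m : ℕ,
        (fun z : ℝ => Zaremba.K k (z ^ k ^ m)) ~[𝓝[<] 1]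
          (fun z : ℝ => 1 / Zaremba.alpha k ^ m *
            (C z / (1 - z) ^ Real.logb k (Zaremba.alpha k))) := by
  refine ⟨fun z hz ↦ Zaremba.summable_kappa hk hz, Zaremba.oscFactor k,
    Zaremba.analyticOnNhd_oscFactor hk, ?_, fun z hz ↦ Zaremba.oscFactor_pow hk hz,
    Zaremba.not_tendsto_oscFactor hk, Zaremba.isEquivalent_K_pow hk⟩
  obtain ⟨c₁, c₂, hc, hb⟩ := (Zaremba.hasPowerOrder_sumModel hk).laplace_bounds
    (zero_le_one.trans (Zaremba.one_le_expo hk))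
  exact ⟨c₁, c₂, hc, fun z hz ↦ hb _ (Zaremba.neg_log_pos hz)⟩
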